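/- Let $n\ge 1$. There is a constant $c_n>0$, depending only on $n$, such that the following holds. **Setup.** For $f\in L^2(\mathbb R^n)$ write $\hat f(\xi)=\int e^{-ix\cdot\xi}f(x)\,dx$ and $e^{it\Delta}f(x)=(2\pi)^{-n}\int e^{i(x\cdot\xi+t|\xi|^2)}\hat f(\xi)\,d\xi$. Let $K>0$, $M\ge 1$, $R>0$, $1\le p,r<\infty$, and let $A\ge 0$ and $2\le k\le n+2$ be integers. Let $\xi_0\in\mathbb R^n$ with $|\xi_0|\le 1$, and let $f\in L^2(\mathbb R^n)$ with $\operatorname{supp}\hat f\subset B(\xi_0,M^{-1})$ (the case $\xi_0=0$, $M=1$ is $\operatorname{supp}\hat f\subset B(0,1)$). Decompose, up to null sets, * $B(\xi_0,M^{-1})$ into finitely many measurable pieces $\tau$, each contained in a ball of radius $(KM)^{-1}$; * $B^n(0,R)$ into finitely many measurable pieces $B_K$, each contained in a ball of radius $K$; * $[0,R]$ into finitely many intervals $I_K$ of length at most $K$. Here "decompose" means that the pieces are disjoint up to null sets and cover the given set up to a null set; pieces may stick out at the boundary. Define $f_\tau$ by $\widehat{f_\tau}=\hat f\,1_\tau$.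 Put $G(\xi)=(-2\xi,1)/|(-2\xi,1)|\in\mathbb R^n\times\mathbb R$ and $G(\tau)=\{G(\xi):\xi\in\tau\}$. For a subspace $V\subset\mathbb R^n\times\mathbb R$, let $\mathrm{Angle}(G(\tau),V)$ be the infimum of the angles between nonzero vectors of $V$ and vectors of $G(\tau)$. Define $$\mu_{e^{it\Delta}f}(B_K\times I_K)=\min_{V_1,\dots,V_A}\ \max_{\tau:\ \mathrm{Angle}(G(\tau),V_a)>(KM)^{-1}\ \forall a}\ \int_{B_K\times I_K}|e^{it\Delta}f_\tau(x)|^p\,dx\,dt ,$$ where the $V_a$ range over the $(k-1)$-dimensional subspaces of $\mathbb R^n\times\mathbb R$ and a maximum over no $\tau$ is $0$. For $U\subset B^n(0,R)\times[0,R]$ define $$\|e^{it\Delta}f\|^p_{BL^p_{k,A}L^r(U)}=\sum_{B_K}\Big[\sum_{I_K}\Big(\frac{|U\cap(B_K\times I_K)|}{|B_K\times I_K|}\,\mu_{e^{it\Delta}f}(B_K\times I_K)\Big)^r\Big]^{1/r},$$ where $|\cdot|$ is Lebesgue (outer) measure and terms with $|B_K\times I_K|=0$ are $0$. **Theorem.**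 For every $U\subset B^n(0,R)\times[0,R]$ and every real $D\ge 1$ there is a nonzero polynomial $P$ on $\mathbb R^n\times\mathbb R$ of degree at most $D$ such that $(\mathbb R^n\times\mathbb R)\setminus Z(P)$, where $Z(P)=\{P=0\}$, is the union of $L$ pairwise disjoint nonempty open sets $O_1,\dots,O_L$ with $$c_n^{-1}D^{n+1}\le L\le c_nD^{n+1},$$ and for every $i$ $$\|e^{it\Delta}f\|^p_{BL^p_{k,A}L^r(U)}\le c_nD^{n+1}\,\|e^{it\Delta}f\|^p_{BL^p_{k,A}L^r(U\cap O_i)} .$$ -/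

import Mathlib

open MeasureTheory Set
open scoped ENNReal FourierTransform

namespace SchrodingerBroad

noncomputable section

/-- Physical (or frequency) space `ℝⁿ` with its Euclidean norm and Lebesgue measure. -/
abbrev Space (n : ℕ) : Type := EuclideanSpace ℝ (Fin n)

/-- Space-time `ℝⁿ × ℝ`, with points `(x, t)` and product Lebesgue measure. -/
abbrev SpaceTime (n : ℕ) : Type := Space n × ℝ

/-- Space-time with its Euclidean inner product; angles and subspaces live here. -/
abbrev EuclideanSpaceTime (n : ℕ) : Type := WithLp 2 (Space n × ℝ)

/-- The Fourier transform of `f ∈ L²(ℝⁿ)` in the angular-frequency normalization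
`f̂(ξ) = ∫ e^{-i x·ξ} f(x) dx`. Mathlib's `𝓕 f (η)` is `∫ e^{-2πi x·η} f(x) dx`, extended
to `L²` by Plancherel, so that `f̂(ξ) = 𝓕 f (ξ / 2π)`. -/
def hat {n : ℕ} (f : Lp ℂ 2 (volume : Measure (Space n))) (ξ : Space n) : ℂ :=
  (𝓕 f : Lp ℂ 2 (volume : Measure (Space n))) ((2 * Real.pi)⁻¹ • ξ)

/-- The support of `f̂` is contained in the ball of centre `ξ₀` and radius `ρ`. -/
def FourierSupportedIn {n : ℕ} (f : Lp ℂ 2 (volume : Measure (Space n)))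
    (ξ₀ : Space n) (ρ : ℝ) : Prop :=
  ∀ᵐ ξ : Space n, ξ ∉ Metric.closedBall ξ₀ ρ → hat f ξ = 0

/-- The free Schrödinger solution whose initial datum has Fourier transform `g`:
`(2π)^{-n} ∫ e^{i (x·ξ + t |ξ|²)} g(ξ) dξ`. -/
def evolve {n : ℕ} (g : Space n → ℂ) (x : Space n) (t : ℝ) : ℂ :=
  (((2 * Real.pi) ^ n)⁻¹ : ℝ) *
    ∫ ξ : Space n, Complex.exp (Complex.I * ((inner ℝ x ξ + t * ‖ξ‖ ^ 2 : ℝ) : ℂ)) * g ξ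

/-- `e^{itΔ} f_τ (x)`, where `f_τ` is the function whose Fourier transform is `f̂` restricted
to `τ`. -/
def evolvePiece {n : ℕ} (f : Lp ℂ 2 (volume : Measure (Space n))) (τ : Set (Space n))
    (x : Space n) (t : ℝ) : ℂ :=
  evolve (τ.indicator (hat f)) x t

/-- The finite family `piece` decomposes the ball of centre `c` and radius `ρ` into pieces at
scale `σ`: the pieces are measurable, overlap in null sets only, cover the ball up to a null set,
and each of them lies in some ball of radius `σ`. (A ball cannot literally be partitioned into
balls; pieces truncated at the boundary or sticking out of the ball are both allowed.) -/
structure IsBallDecomposition {n N : ℕ} (c : Space n) (ρ σ : ℝ)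
    (piece : Fin N → Set (Space n)) : Prop where
  measurableSet : ∀ i, MeasurableSet (piece i)
  disjoint : Pairwise fun i j => volume (piece i ∩ piece j) = 0
  covers : volume (Metric.closedBall c ρ \ ⋃ i, piece i) = 0
  small : ∀ i, ∃ a : Space n, piece i ⊆ Metric.closedBall a σ

/-- The finite family `piece` decomposes `[0, R]` into intervals of length (at most) `K`,
overlapping in null sets only. -/
structure IsIntervalDecomposition {N : ℕ} (R K : ℝ) (piece : Fin N → Set ℝ) : Prop where
  interval : ∀ i, (piece i).OrdConnected
  disjoint : Pairwise fun i j => volume (piece i ∩ piece j) = 0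
  covers : volume (Icc 0 R \ ⋃ i, piece i) = 0
  small : ∀ i, ∃ a : ℝ, piece i ⊆ Icc a (a + K)

/-- The unit vector `G(ξ) = (-2ξ, 1) / |(-2ξ, 1)|`. -/
def direction {n : ℕ} (ξ : Space n) : EuclideanSpaceTime n :=
  ‖(WithLp.toLp 2 ((-2 : ℝ) • ξ, (1 : ℝ)) : EuclideanSpaceTime n)‖⁻¹ •
    (WithLp.toLp 2 ((-2 : ℝ) • ξ, (1 : ℝ)) : EuclideanSpaceTime n)

/-- `Angle(S, V)`: the smallest angle between a nonzero vector of the subspace `V` and a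
nonzero vector of the set `S`. -/
def setAngle {n : ℕ} (S : Set (EuclideanSpaceTime n))
    (V : Submodule ℝ (EuclideanSpaceTime n)) : ℝ :=
  sInf {θ : ℝ | ∃ v ∈ V, ∃ w ∈ S, v ≠ 0 ∧ w ≠ 0 ∧ θ = InnerProductGeometry.angle v w}

/-- The quantity `μ_{e^{itΔ} f}(Q)`: the minimum over `(k-1)`-dimensional subspaces
`V₁, …, V_A` of the maximum, over those pieces `τ` with `Angle(G(τ), V_a) > (KM)⁻¹` for every
`a`, of `∫_Q |e^{itΔ} f_τ|^p` (a maximum over no piece being `0`). -/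
def broadMass {n N : ℕ} (k A : ℕ) (K M p : ℝ) (τ : Fin N → Set (Space n))
    (f : Lp ℂ 2 (volume : Measure (Space n))) (Q : Set (SpaceTime n)) : ℝ≥0∞ :=
  ⨅ V : Fin A → {V : Submodule ℝ (EuclideanSpaceTime n) // Module.finrank ℝ V = k - 1},
    ⨆ j : {j : Fin N // ∀ a, (K * M)⁻¹ < setAngle (direction '' τ j) (V a).1},
      ∫⁻ z in Q, ‖evolvePiece f (τ j.1) z.1 z.2‖ₑ ^ p

/-- The `p`-th power `‖e^{itΔ} f‖^p` of the broad norm `BL^p_{k,A} L^r (U)`: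
`∑_B [ ∑_I ( |U ∩ (B × I)| / |B × I| · μ_{e^{itΔ} f}(B × I) )^r ]^{1/r}`.
For a non-measurable `U`, `|·|` is Lebesgue outer measure. -/
def broadNormPow {n N N₁ N₂ : ℕ} (k A : ℕ) (K M p r : ℝ) (τ : Fin N → Set (Space n))
    (B : Fin N₁ → Set (Space n)) (I : Fin N₂ → Set ℝ)
    (f : Lp ℂ 2 (volume : Measure (Space n))) (U : Set (SpaceTime n)) : ℝ≥0∞ :=
  ∑ b, (∑ m, (volume (U ∩ B b ×ˢ I m) / volume (B b ×ˢ I m) *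
    broadMass k A K M p τ f (B b ×ˢ I m)) ^ r) ^ (1 / r)

/-- The value `P(x, t)` of a real polynomial in `n` space variables and one time variable. -/
def polyEval {n : ℕ} (P : MvPolynomial (Fin n ⊕ Unit) ℝ) (z : SpaceTime n) : ℝ :=
  MvPolynomial.eval (Sum.elim z.1 fun _ => z.2) P

/-- The variety `Z(P) = {(x, t) : P(x, t) = 0}`. -/
def zeroSet {n : ℕ} (P : MvPolynomial (Fin n ⊕ Unit) ℝ) : Set (SpaceTime n) :=
  {z | polyEval P z = 0}

end

end SchrodingerBroad

/-!
Polynomial partitioning for the broad norm, by iterated bisection.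

The weights `|U ∩ Q| / |Q| · μ(Q)` of the cells `Q = B × I` define finite measures, absolutely
continuous with respect to Lebesgue measure, and the `p`-th power of the broad norm of `U ∩ O` is
the `ℓ¹(ℓ^r)` norm of their values at `O` (`broadNormPow_inter_eq_mixedNorm`,
`broadMass_ne_top`). If a polynomial `P` gives the sets `O ∩ {P > 0}` and `O ∩ {P < 0}` equal
norms, then, since `{P = 0}` is a null set (`volume_zeroSet`), each of the two carries at least
half of the norm of `O`, by the triangle inequality alone. The polynomial ham sandwich theorem
(`exists_mixedNorm_inter_posSet_eq`) bisects `2 ^ j` sets simultaneously by a polynomial of degree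
`O(2 ^ (j / (n + 1)))`; the degrees of the successive steps form a geometric sum, so that
`2 ^ J ∼ D ^ (n + 1)` cells are reached within degree `D` (`exists_partition_two_pow`,
`exists_partition_of_one_le`). When the norm of `U` is zero, its bisections might have empty
halves, and Lebesgue measure on the unit ball is bisected instead.

The ham sandwich theorem rests on the Borsuk–Ulam theorem (`exists_ne_zero_eq_zero_of_odd`),
which is proved algebraically. On the sphere an odd map into `ℝ^σ` is approximated by odd
polynomials; in the affine chart `x ↦ (1, x) / |(1, x)|` these become polynomials `q_i` of degree
at most `d`, with `d` odd, in as many variables as there are polynomials. It is enough to find a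
real zero of `f_i = δ X_i ^ d + q_i` for arbitrarily small `δ > 0`
(`MvPolynomial.exists_eval_eq_zero_of_odd`). For all but finitely many `δ` the products
`∏ X_i ^ a_i f_i ^ b_i` with `a_i < d` and total weight `∑ (a_i + d b_i) ≤ e` span the polynomials
of degree at most `e`; as there are as many of them as monomials `X ^ (a + d b)`, they form a
basis. Hence the quotient by the ideal of the `f_i` has dimension `d ^ |σ|`, which is odd, and on
a real vector space of odd dimension commuting operators, here the multiplications, have a common
eigenvector (`exists_common_eigenvector_of_odd_finrank`); the eigenvalues of the variables are the
coordinates of a real zero.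
-/

/-! ### Commuting operators on a real vector space of odd dimension -/

theorem Polynomial.exists_isRoot_of_monic_of_odd {p : Polynomial ℝ} (hp : p.Monic)
    (hodd : Odd p.natDegree) : ∃ x, p.IsRoot x := by
  have hpos : 0 < p.natDegree := hodd.pos
  have htop : Filter.Tendsto (fun x => p.eval x) Filter.atTop Filter.atTop :=
    p.tendsto_atTop_of_leadingCoeff_nonneg (Polynomial.natDegree_pos_iff_degree_pos.1 hpos)
      (by rw [hp.leadingCoeff]; exact zero_le_one)
  have hnd : (p.comp (-Polynomial.X)).natDegree = p.natDegree := by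
    rw [Polynomial.natDegree_comp]; simp
  have hbot : Filter.Tendsto (fun x => (p.comp (-Polynomial.X)).eval x)
      Filter.atTop Filter.atBot := by
    apply Polynomial.tendsto_atBot_of_leadingCoeff_nonpos
    · rw [← Polynomial.natDegree_pos_iff_degree_pos, hnd]; exact hpos
    · rw [Polynomial.leadingCoeff_comp (by simp)]
      simp [hp.leadingCoeff, hodd.neg_one_pow]
  obtain ⟨a, ha⟩ := (htop.eventually (Filter.eventually_ge_atTop 0)).exists
  obtain ⟨b, hb⟩ := (hbot.eventually (Filter.eventually_le_atBot 0)).exists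
  rw [Polynomial.eval_comp] at hb
  have := mem_range_of_exists_le_of_exists_ge p.continuous ⟨_, hb⟩ ⟨a, ha⟩
  exact this

theorem Module.End.exists_hasEigenvalue_of_odd_finrank {V : Type*} [AddCommGroup V] [Module ℝ V]
    [FiniteDimensional ℝ V] (hodd : Odd (Module.finrank ℝ V)) (T : Module.End ℝ V) :
    ∃ c, T.HasEigenvalue c := by
  obtain ⟨c, hc⟩ := Polynomial.exists_isRoot_of_monic_of_odd (LinearMap.charpoly_monic T)
    (by rwa [LinearMap.charpoly_natDegree])
  exact ⟨c, (Module.End.hasEigenvalue_iff_isRoot_charpoly T c).2 hc⟩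

/-- If some operator is not a scalar, subtract one of its eigenvalues: kernel and range of the
difference are proper invariant subspaces whose dimensions have an odd sum, so that one of them
is again of odd dimension. -/
theorem exists_common_eigenvector_of_odd_finrank {ι : Type*} {V : Type*} [AddCommGroup V]
    [Module ℝ V] [FiniteDimensional ℝ V] (T : ι → Module.End ℝ V)
    (hT : ∀ i j, Commute (T i) (T j)) (hodd : Odd (Module.finrank ℝ V)) :
    ∃ v : V, v ≠ 0 ∧ ∀ i, ∃ c : ℝ, T i v = c • v := by
  induction hm : Module.finrank ℝ V using Nat.strong_induction_on generalizing V with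
  | _ m ih =>
  subst hm
  have : Nontrivial V := Module.finrank_pos_iff.1 hodd.pos
  by_cases hsc : ∀ i, ∃ c : ℝ, T i = c • LinearMap.id
  · obtain ⟨v, hv⟩ := exists_ne (0 : V)
    refine ⟨v, hv, fun i => ?_⟩
    obtain ⟨c, hc⟩ := hsc i
    exact ⟨c, by simp [hc]⟩
  push Not at hsc
  obtain ⟨i, hi⟩ := hsc
  obtain ⟨c, hc⟩ := Module.End.exists_hasEigenvalue_of_odd_finrank hodd (T i)
  have key : ∀ W : Submodule ℝ V, W ≠ ⊤ → (∀ j, ∀ w ∈ W, T j w ∈ W) →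
      Odd (Module.finrank ℝ W) → ∃ v : V, v ≠ 0 ∧ ∀ i, ∃ c : ℝ, T i v = c • v := by
    intro W hW hinv hWodd
    obtain ⟨v, hv, h⟩ := ih _ (Submodule.finrank_lt hW) (fun j => (T j).restrict (hinv j))
      (fun j k => by
        ext w
        exact congrArg (fun S : Module.End ℝ V => S w.1) (hT j k).eq) hWodd rfl
    refine ⟨v, by simpa using hv, fun j => ?_⟩
    obtain ⟨c, hc⟩ := h j
    exact ⟨c, congrArg Subtype.val hc⟩
  set S : Module.End ℝ V := T i - c • LinearMap.id with hS
  have hcomm : ∀ j w, S (T j w) = T j (S w) := by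
    intro j w
    have := congrArg (fun S : Module.End ℝ V => S w) (hT i j).eq
    simp only [Module.End.mul_apply] at this
    simp [hS, this]
  have hne : S ≠ 0 := fun h => hi c (sub_eq_zero.1 h)
  have hker : LinearMap.ker S ≠ ⊥ := by
    obtain ⟨v, hv⟩ := hc.exists_hasEigenvector
    intro h
    apply hv.2
    rw [← Submodule.mem_bot ℝ, ← h, LinearMap.mem_ker]
    simp [hS, hv.apply_eq_smul]
  have hsum := LinearMap.finrank_range_add_finrank_ker S
  rw [← hsum, Nat.odd_add] at hodd
  by_cases hr : Odd (Module.finrank ℝ (LinearMap.range S))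
  · refine key (LinearMap.range S) (fun h => hker ?_) ?_ hr
    · exact LinearMap.ker_eq_bot.2 (LinearMap.injective_iff_surjective.2 (LinearMap.range_eq_top.1 h))
    · rintro j _ ⟨w, rfl⟩
      exact ⟨T j w, hcomm j w⟩
  · refine key (LinearMap.ker S) (fun h => hne (LinearMap.ker_eq_top.1 h)) ?_ ?_
    · intro j w hw
      rw [LinearMap.mem_ker] at hw ⊢
      rw [hcomm, hw, map_zero]
    · rw [← Nat.not_even_iff_odd]
      exact fun h => hr (hodd.2 h)

/-! ### Real zeros of perturbed polynomial systems of odd degree -/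

namespace MvPolynomial

theorem restrictTotalDegree_le_iff {σ : Type*} {e : ℕ} {N : Submodule ℝ (MvPolynomial σ ℝ)} :
    restrictTotalDegree σ ℝ e ≤ N ↔ ∀ γ : σ →₀ ℕ, γ.degree ≤ e → monomial γ 1 ∈ N := by
  constructor
  · intro h γ hγ
    refine h ((mem_restrictTotalDegree _ _ _).2 ?_)
    rw [totalDegree_monomial _ one_ne_zero]
    exact hγ
  · intro h g hg
    rw [g.as_sum]
    refine N.sum_mem fun γ hγ => ?_
    rw [← mul_one (coeff γ g), ← smul_eq_mul, ← smul_monomial]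
    exact N.smul_mem _ (h γ ((le_totalDegree hγ).trans ((mem_restrictTotalDegree _ _ _).1 hg)))

theorem monomial_one_mem_restrictTotalDegree {σ : Type*} {e : ℕ} {γ : σ →₀ ℕ} :
    (monomial γ 1 : MvPolynomial σ ℝ) ∈ restrictTotalDegree σ ℝ e ↔ γ.degree ≤ e := by
  rw [mem_restrictTotalDegree, totalDegree_monomial _ one_ne_zero]
  rfl

variable {σ : Type*} [Fintype σ]

/-- The product `∏ i, X_i ^ (γ_i % d) * f_i ^ (γ_i / d)`: the monomial `X ^ γ` with each factor
`X_i ^ d` replaced by `f_i`. -/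
noncomputable def mixedProd (d : ℕ) (f : σ → MvPolynomial σ ℝ) (γ : σ →₀ ℕ) :
    MvPolynomial σ ℝ :=
  ∏ i, (X i ^ (γ i % d) * f i ^ (γ i / d))

theorem mixedProd_of_lt {d : ℕ} (f : σ → MvPolynomial σ ℝ) {γ : σ →₀ ℕ} (hγ : ∀ i, γ i < d) :
    mixedProd d f γ = monomial γ 1 := by
  rw [mixedProd, monomial_eq, C_1, one_mul, Finsupp.prod_fintype _ _ (by simp)]
  refine Finset.prod_congr rfl fun i _ => ?_
  rw [Nat.mod_eq_of_lt (hγ i), Nat.div_eq_of_lt (hγ i), pow_zero, mul_one]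

theorem mixedProd_add_single {d : ℕ} (hd : 0 < d) (f : σ → MvPolynomial σ ℝ) (γ : σ →₀ ℕ)
    (i : σ) : mixedProd d f (γ + Finsupp.single i d) = f i * mixedProd d f γ := by
  classical
  rw [mixedProd, mixedProd, ← Finset.mul_prod_erase _ _ (Finset.mem_univ i),
    ← Finset.mul_prod_erase (a := i) Finset.univ (fun i => X i ^ (γ i % d) * f i ^ (γ i / d))
      (Finset.mem_univ i)]
  have : ∀ j ∈ Finset.univ.erase i, (γ + Finsupp.single i d) j = γ j := by
    intro j hj
    simp [(Finset.ne_of_mem_erase hj).symm]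
  rw [Finset.prod_congr rfl fun j hj => by rw [this j hj]]
  simp only [Finsupp.add_apply, Finsupp.single_eq_same, Nat.add_mod_right,
    Nat.add_div_right _ hd, pow_succ]
  ring

theorem mixedProd_mem_restrictTotalDegree {d : ℕ} {f : σ → MvPolynomial σ ℝ}
    (hf : ∀ i, (f i).totalDegree ≤ d) {γ : σ →₀ ℕ} {e : ℕ} (hγ : γ.degree ≤ e) :
    mixedProd d f γ ∈ restrictTotalDegree σ ℝ e := by
  rw [mem_restrictTotalDegree]
  refine (totalDegree_finsetProd _ _).trans (le_trans ?_ hγ)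
  rw [Finsupp.degree_eq_sum]
  refine Finset.sum_le_sum fun i _ => (totalDegree_mul _ _).trans ?_
  calc _ ≤ γ i % d + γ i / d * d := by
        rw [totalDegree_X_pow]
        gcongr
        exact (totalDegree_pow _ _).trans (Nat.mul_le_mul_left _ (hf i))
    _ = γ i := Nat.mod_add_div' _ _

open Classical in
/-- The linear map replacing, in each monomial that some `X_i ^ d` divides, one such factor by
`q_i`; monomials with all exponents below `d` are sent to zero. -/
noncomputable def substStep (d : ℕ) (q : σ → MvPolynomial σ ℝ) :
    Module.End ℝ (MvPolynomial σ ℝ) :=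
  (basisMonomials σ ℝ).constr ℝ fun γ =>
    if h : ∃ i, d ≤ γ i then
      monomial (γ - Finsupp.single h.choose d) 1 * q h.choose else 0

theorem substStep_monomial_of_lt {d : ℕ} (q : σ → MvPolynomial σ ℝ) {γ : σ →₀ ℕ}
    (hγ : ∀ i, γ i < d) : substStep d q (monomial γ 1) = 0 := by
  have h := (basisMonomials σ ℝ).constr_basis ℝ (fun γ => open Classical in
    if h : ∃ i, d ≤ γ i then
      monomial (γ - Finsupp.single h.choose d) 1 * q h.choose else 0) γ
  rw [coe_basisMonomials] at h
  rw [substStep, h, dif_neg]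
  push Not
  exact hγ

theorem exists_substStep_monomial {d : ℕ} (q : σ → MvPolynomial σ ℝ) {γ : σ →₀ ℕ}
    (hγ : ∃ i, d ≤ γ i) : ∃ (i : σ) (β : σ →₀ ℕ), γ = β + Finsupp.single i d ∧
      substStep d q (monomial γ 1) = monomial β 1 * q i := by
  have h := (basisMonomials σ ℝ).constr_basis ℝ (fun γ => open Classical in
    if h : ∃ i, d ≤ γ i then
      monomial (γ - Finsupp.single h.choose d) 1 * q h.choose else 0) γ
  rw [coe_basisMonomials] at h
  refine ⟨hγ.choose, γ - Finsupp.single hγ.choose d, ?_, ?_⟩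
  · rw [tsub_add_cancel_of_le]
    rw [Finsupp.single_le_iff]
    exact hγ.choose_spec
  · rw [substStep, h, dif_pos hγ]

theorem substStep_mem_restrictTotalDegree {d : ℕ} {q : σ → MvPolynomial σ ℝ}
    (hq : ∀ i, (q i).totalDegree ≤ d) (e : ℕ) :
    ∀ g ∈ restrictTotalDegree σ ℝ e, substStep d q g ∈ restrictTotalDegree σ ℝ e := by
  change restrictTotalDegree σ ℝ e ≤ (restrictTotalDegree σ ℝ e).comap (substStep d q)
  rw [restrictTotalDegree_le_iff]
  intro γ hγ
  rw [Submodule.mem_comap]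
  by_cases h : ∃ i, d ≤ γ i
  · obtain ⟨i, β, rfl, hβ⟩ := exists_substStep_monomial q h
    rw [map_add, Finsupp.degree_single] at hγ
    rw [hβ, mem_restrictTotalDegree]
    refine (totalDegree_mul _ _).trans (le_trans ?_ hγ)
    exact add_le_add (by rw [totalDegree_monomial _ one_ne_zero]; rfl) (hq i)
  · push Not at h
    rw [substStep_monomial_of_lt q h]
    exact zero_mem _

/-- A real number that is not an eigenvalue of `-substStep d q` on polynomials of degree at most
`E` works; there are only finitely many eigenvalues. -/
theorem exists_smul_add_substStep_surjective {d : ℕ} {q : σ → MvPolynomial σ ℝ}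
    (hq : ∀ i, (q i).totalDegree ≤ d) (E : ℕ) {η : ℝ} (hη : 0 < η) :
    ∃ δ, 0 < δ ∧ δ < η ∧ ∀ e ≤ E, ∀ g ∈ restrictTotalDegree σ ℝ e,
      ∃ h ∈ restrictTotalDegree σ ℝ e, δ • h + substStep d q h = g := by
  let T : Module.End ℝ (restrictTotalDegree σ ℝ E) :=
    (substStep d q).restrict (substStep_mem_restrictTotalDegree hq E)
  have hfin : ((fun δ : ℝ => -δ) ⁻¹' {μ | T.HasEigenvalue μ}).Finite :=
    (Module.End.finite_hasEigenvalue T).preimage neg_injective.injOn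
  obtain ⟨δ, hδ, hδ'⟩ := ((Set.Ioo_infinite hη).sdiff hfin).nonempty
  refine ⟨δ, hδ.1, hδ.2, fun e he g hg => ?_⟩
  let S : Module.End ℝ (MvPolynomial σ ℝ) := δ • LinearMap.id + substStep d q
  have hmaps : ∀ h ∈ restrictTotalDegree σ ℝ e,
      S h ∈ restrictTotalDegree σ ℝ e := fun h hh =>
    Submodule.add_mem _ (Submodule.smul_mem _ _ hh) (substStep_mem_restrictTotalDegree hq e h hh)
  have hinj : Function.Injective (S.restrict hmaps) := by
    rw [← LinearMap.ker_eq_bot, LinearMap.ker_eq_bot']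
    rintro ⟨h, hh⟩ h0
    by_contra hne
    have h0' : δ • h + substStep d q h = 0 := congrArg Subtype.val h0
    have hhE : h ∈ restrictTotalDegree σ ℝ E := by
      rw [mem_restrictTotalDegree] at hh ⊢
      exact hh.trans he
    apply hδ'
    refine Module.End.hasEigenvalue_of_hasEigenvector (x := ⟨h, hhE⟩) ⟨?_, ?_⟩
    · rw [Module.End.mem_eigenspace_iff]
      apply Subtype.ext
      change substStep d q h = (-δ) • h
      rw [neg_smul]
      exact eq_neg_of_add_eq_zero_right h0'
    · intro hz
      apply hne
      have h0 : h = 0 := congrArg Subtype.val hz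
      exact Subtype.ext h0
  obtain ⟨⟨h, hh⟩, heq⟩ := LinearMap.injective_iff_surjective.1 hinj ⟨g, hg⟩
  exact ⟨h, hh, congrArg Subtype.val heq⟩

/-- If `δ + substStep d q` is surjective on polynomials of each degree up to a fixed large bound,
then the mixed products of the `δ X_i ^ d + q_i` span the polynomials of every degree. -/
theorem restrictTotalDegree_le_span_mixedProd {d : ℕ} (hd : 0 < d) {q : σ → MvPolynomial σ ℝ}
    {δ : ℝ} (hsurj : ∀ e ≤ Fintype.card σ * d + 1,
      ∀ g ∈ restrictTotalDegree σ ℝ e,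
        ∃ h ∈ restrictTotalDegree σ ℝ e, δ • h + substStep d q h = g) (e : ℕ) :
    restrictTotalDegree σ ℝ e ≤
      Submodule.span ℝ (mixedProd d (fun i => C δ * X i ^ d + q i) '' {γ | γ.degree ≤ e}) := by
  classical
  set f : σ → MvPolynomial σ ℝ := fun i => C δ * X i ^ d + q i with hf
  set E := Fintype.card σ * d + 1 with hE
  set V : ℕ → Submodule ℝ (MvPolynomial σ ℝ) :=
    fun e => Submodule.span ℝ (mixedProd d f '' {γ | γ.degree ≤ e}) with hV
  have hmono : ∀ {a b}, a ≤ b → V a ≤ V b := fun hab =>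
    Submodule.span_mono (Set.image_mono fun γ hγ => le_trans hγ hab)
  have hmul : ∀ (e : ℕ) (i : σ), ∀ g ∈ V e, f i * g ∈ V (e + d) := by
    intro e i
    change V e ≤ (V (e + d)).comap (LinearMap.mulLeft ℝ (f i))
    rw [hV, Submodule.span_le]
    rintro _ ⟨γ, hγ, rfl⟩
    refine Submodule.subset_span ⟨γ + Finsupp.single i d, ?_, ?_⟩
    · have : γ.degree ≤ e := hγ
      change (γ + Finsupp.single i d).degree ≤ e + d
      rw [map_add, Finsupp.degree_single]
      omega
    · rw [mixedProd_add_single hd]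
      rfl
  induction e using Nat.strong_induction_on with
  | _ e ih =>
  -- The image of a monomial under `δ + substStep d q`, times a further monomial, lies in the span
  -- as soon as the first monomial is divisible by some `X_i ^ d`.
  have hstep : ∀ (ζ γ : σ →₀ ℕ), (∃ i, d ≤ γ i) → ζ.degree + γ.degree ≤ e →
      monomial ζ 1 * (δ • monomial γ 1 + substStep d q (monomial γ 1)) ∈ V e := by
    intro ζ γ hγ hdeg
    obtain ⟨i, β, rfl, hβ⟩ := exists_substStep_monomial q hγ
    rw [map_add, Finsupp.degree_single] at hdeg
    have : monomial ζ 1 * (δ • monomial (β + Finsupp.single i d) 1 +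
        substStep d q (monomial (β + Finsupp.single i d) 1)) = f i * monomial (ζ + β) 1 := by
      have h1 : (monomial (β + Finsupp.single i d) 1 : MvPolynomial σ ℝ) =
          monomial β 1 * X i ^ d := by
        rw [X_pow_eq_monomial, monomial_mul, one_mul]
      have h2 : (monomial (ζ + β) 1 : MvPolynomial σ ℝ) = monomial ζ 1 * monomial β 1 := by
        rw [monomial_mul, one_mul]
      rw [hβ, h1, h2, hf, smul_eq_C_mul]
      ring
    rw [this]
    refine hmono (show e - d + d ≤ e by omega) (hmul _ i _ (ih (e - d) (by omega) ?_))
    rw [monomial_one_mem_restrictTotalDegree, map_add]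
    omega
  rw [restrictTotalDegree_le_iff]
  intro γ hγ
  by_cases hle : γ.degree ≤ E
  · obtain ⟨h, hh, heq⟩ := hsurj γ.degree hle (monomial γ 1)
      (monomial_one_mem_restrictTotalDegree.2 le_rfl)
    rw [← heq]
    suffices restrictTotalDegree σ ℝ γ.degree ≤
      (V e).comap (δ • LinearMap.id + substStep d q) from this hh
    rw [restrictTotalDegree_le_iff]
    intro α hα
    change δ • monomial α 1 + substStep d q (monomial α 1) ∈ V e
    by_cases hred : ∃ i, d ≤ α i
    · simpa using hstep 0 α hred (by simpa using hα.trans hγ)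
    · push Not at hred
      rw [substStep_monomial_of_lt q hred, add_zero, ← mixedProd_of_lt f hred]
      exact Submodule.smul_mem _ _ (Submodule.subset_span ⟨α, hα.trans hγ, rfl⟩)
  · push Not at hle
    obtain ⟨γ', hle', hdeg'⟩ := Finsupp.exists_le_degree_eq γ E hle.le
    obtain ⟨ζ, rfl⟩ := exists_add_of_le hle'
    rw [map_add] at hγ
    obtain ⟨h, hh, heq⟩ := hsurj E le_rfl (monomial γ' 1)
      (monomial_one_mem_restrictTotalDegree.2 hdeg'.le)
    have h3 : (monomial (γ' + ζ) 1 : MvPolynomial σ ℝ) = monomial ζ 1 * monomial γ' 1 := by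
      rw [monomial_mul, one_mul, add_comm]
    rw [h3, ← heq]
    suffices restrictTotalDegree σ ℝ E ≤ (V e).comap
        (LinearMap.mulLeft ℝ (monomial ζ 1) ∘ₗ (δ • LinearMap.id + substStep d q)) from this hh
    rw [restrictTotalDegree_le_iff]
    intro α hα
    change monomial ζ 1 * (δ • monomial α 1 + substStep d q (monomial α 1)) ∈ V e
    by_cases hred : ∃ i, d ≤ α i
    · exact hstep ζ α hred (by omega)
    · push Not at hred
      rw [substStep_monomial_of_lt q hred, add_zero, mul_smul_comm, monomial_mul, one_mul]
      -- A monomial with all exponents below `d` has degree less than `E`.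
      have hlt : α.degree < E := by
        rw [Finsupp.degree_eq_sum, hE]
        refine Nat.lt_succ_of_le ?_
        rw [← smul_eq_mul, ← Finset.card_univ]
        exact Finset.sum_le_card_nsmul _ _ _ fun i _ => (hred i).le
      refine Submodule.smul_mem _ _ (hmono (show e - 1 ≤ e by omega) (ih (e - 1) (by omega) ?_))
      rw [monomial_one_mem_restrictTotalDegree, map_add]
      omega

/-- A surjection of the finite-dimensional space of polynomials of degree at most `e` onto itself
is injective: there are as many mixed products as monomials. -/
theorem bijective_constr_mixedProd {d : ℕ} {f : σ → MvPolynomial σ ℝ}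
    (hf : ∀ i, (f i).totalDegree ≤ d)
    (hspan : ∀ e, restrictTotalDegree σ ℝ e ≤
      Submodule.span ℝ (mixedProd d f '' {γ | γ.degree ≤ e})) :
    Function.Bijective ((basisMonomials σ ℝ).constr ℝ (mixedProd d f)) := by
  set Φ := (basisMonomials σ ℝ).constr ℝ (mixedProd d f) with hΦ
  have hΦm : ∀ γ, Φ (monomial γ 1) = mixedProd d f γ := fun γ => by
    have := (basisMonomials σ ℝ).constr_basis ℝ (mixedProd d f) γ
    rwa [coe_basisMonomials] at this
  have hmaps : ∀ e, ∀ g ∈ restrictTotalDegree σ ℝ e, Φ g ∈ restrictTotalDegree σ ℝ e := by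
    intro e
    change restrictTotalDegree σ ℝ e ≤ (restrictTotalDegree σ ℝ e).comap Φ
    rw [restrictTotalDegree_le_iff]
    intro γ hγ
    rw [Submodule.mem_comap, hΦm]
    exact mixedProd_mem_restrictTotalDegree hf hγ
  have hsurj : ∀ e, Function.Surjective (Φ.restrict (hmaps e)) := by
    rintro e ⟨g, hg⟩
    have hmap : Submodule.span ℝ (mixedProd d f '' {γ | γ.degree ≤ e}) ≤
        (restrictTotalDegree σ ℝ e).map Φ := by
      rw [Submodule.span_le]
      rintro _ ⟨γ, hγ, rfl⟩
      exact ⟨monomial γ 1, monomial_one_mem_restrictTotalDegree.2 hγ, hΦm γ⟩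
    obtain ⟨h, hh, rfl⟩ := hmap (hspan e hg)
    exact ⟨⟨h, hh⟩, rfl⟩
  constructor
  · rw [← LinearMap.ker_eq_bot, LinearMap.ker_eq_bot']
    intro g hg
    have hmem : g ∈ restrictTotalDegree σ ℝ g.totalDegree := (mem_restrictTotalDegree _ _ _).2 le_rfl
    have := LinearMap.injective_iff_surjective.2 (hsurj g.totalDegree)
    have h0 : (⟨g, hmem⟩ : restrictTotalDegree σ ℝ g.totalDegree) = 0 :=
      this (Subtype.ext (by simpa using hg))
    exact congrArg Subtype.val h0
  · intro g
    obtain ⟨h, hh⟩ := hsurj g.totalDegree ⟨g, (mem_restrictTotalDegree _ _ _).2 le_rfl⟩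
    exact ⟨h.1, congrArg Subtype.val hh⟩

end MvPolynomial

/-- The eigenvalues on a common eigenvector of all multiplications form an algebra homomorphism. -/
theorem nonempty_algHom_real_of_odd_finrank {A : Type*} [CommRing A] [Algebra ℝ A]
    (hodd : Odd (Module.finrank ℝ A)) : Nonempty (A →ₐ[ℝ] ℝ) := by
  have : FiniteDimensional ℝ A := FiniteDimensional.of_finrank_pos hodd.pos
  obtain ⟨v, hv, h⟩ := exists_common_eigenvector_of_odd_finrank
    (fun a : A => LinearMap.mulLeft ℝ a)
    (fun a b => LinearMap.ext fun w => mul_left_comm a b w) hodd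
  choose χ hχ using h
  have hχ' : ∀ a, a * v = χ a • v := hχ
  have huniq : ∀ a c, a * v = c • v → χ a = c := fun a c hac =>
    smul_left_injective ℝ hv ((hχ' a).symm.trans hac)
  refine ⟨AlgHom.ofLinearMap
    { toFun := χ
      map_add' := fun a b => huniq _ _ (by rw [add_mul, hχ', hχ', add_smul])
      map_smul' := fun c a => huniq _ _ (by
        rw [smul_mul_assoc, hχ', smul_smul, RingHom.id_apply, smul_eq_mul]) }
    (huniq _ _ (by rw [one_mul, one_smul]))
    (fun a b => huniq _ _ (by
      rw [mul_assoc, hχ', mul_smul_comm, hχ', smul_smul, mul_comm]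
      rfl))⟩

namespace MvPolynomial

theorem exists_common_zero_of_odd_finrank {σ : Type*} {f : σ → MvPolynomial σ ℝ}
    (hodd : Odd (Module.finrank ℝ (MvPolynomial σ ℝ ⧸ Ideal.span (range f)))) :
    ∃ x : σ → ℝ, ∀ i, eval x (f i) = 0 := by
  obtain ⟨φ⟩ := nonempty_algHom_real_of_odd_finrank hodd
  let ψ : MvPolynomial σ ℝ →ₐ[ℝ] ℝ := φ.comp (Ideal.Quotient.mkₐ ℝ (Ideal.span (range f)))
  refine ⟨fun i => ψ (X i), fun i => ?_⟩
  have h : ψ (f i) = 0 := by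
    change φ (Ideal.Quotient.mk _ (f i)) = 0
    rw [Ideal.Quotient.eq_zero_iff_mem.2 (Ideal.subset_span (mem_range_self i)), map_zero]
  rw [← h, ← coe_aeval_eq_eval]
  exact (DFunLike.congr_fun (aeval_unique ψ) (f i)).symm

variable {σ : Type*} [Fintype σ]

/-- When the mixed products of the `f_i` form a basis, those with all exponents below `d`
represent a basis of the quotient by the ideal of the `f_i`. -/
theorem finrank_quotient_span_of_bijective {d : ℕ} (hd : 0 < d) {f : σ → MvPolynomial σ ℝ}
    (hbij : Function.Bijective ((basisMonomials σ ℝ).constr ℝ (mixedProd d f))) :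
    Module.finrank ℝ (MvPolynomial σ ℝ ⧸ Ideal.span (range f)) = d ^ Fintype.card σ := by
  classical
  set Φ := (basisMonomials σ ℝ).constr ℝ (mixedProd d f) with hΦ
  have hΦm : ∀ γ, Φ (monomial γ 1) = mixedProd d f γ := fun γ => by
    have := (basisMonomials σ ℝ).constr_basis ℝ (mixedProd d f) γ
    rwa [coe_basisMonomials] at this
  let Ψ := LinearEquiv.ofBijective Φ hbij
  have hΨm : ∀ γ, Ψ.symm (mixedProd d f γ) = monomial γ 1 := fun γ => by
    rw [LinearEquiv.symm_apply_eq]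
    exact (hΦm γ).symm
  -- The coefficients at the exponents below `d`, in the basis of mixed products.
  let co : MvPolynomial σ ℝ →ₗ[ℝ] ((σ → Fin d) → ℝ) := LinearMap.pi fun a =>
    lcoeff ℝ (Finsupp.equivFunOnFinite.symm fun i => (a i : ℕ))
  let Λ := co ∘ₗ Ψ.symm.toLinearMap
  have hco : ∀ g a, co g a = coeff (Finsupp.equivFunOnFinite.symm fun i => (a i : ℕ)) g :=
    fun g a => rfl
  have hsurj : Function.Surjective Λ := by
    suffices hcosurj : Function.Surjective co from hcosurj.comp Ψ.symm.surjective
    intro w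
    refine ⟨∑ a, monomial (Finsupp.equivFunOnFinite.symm fun i => (a i : ℕ)) (w a), ?_⟩
    funext b
    rw [hco, coeff_sum, Finset.sum_eq_single b]
    · simp
    · intro a _ hab
      rw [coeff_monomial, if_neg]
      intro h
      apply hab
      funext i
      exact Fin.ext (congrFun (Finsupp.equivFunOnFinite.symm.injective h) i)
    · simp
  have hΛf : ∀ g i, Λ (f i * g) = 0 := by
    intro g i
    obtain ⟨h, rfl⟩ := Ψ.surjective g
    suffices (⊤ : Submodule ℝ _) ≤ LinearMap.ker
        (Λ ∘ₗ LinearMap.mulLeft ℝ (f i) ∘ₗ Ψ.toLinearMap) from this (x := h) trivial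
    rw [← (basisMonomials σ ℝ).span_eq, Submodule.span_le, coe_basisMonomials]
    rintro _ ⟨γ, rfl⟩
    change co (Ψ.symm (f i * Φ (monomial γ 1))) = 0
    rw [hΦm, ← mixedProd_add_single hd, hΨm]
    funext a
    rw [hco, coeff_monomial, if_neg]
    · rfl
    · intro h
      have := DFunLike.congr_fun h i
      simp only [Finsupp.add_apply, Finsupp.single_eq_same, Finsupp.equivFunOnFinite_symm_apply_apply]
        at this
      have := (a i).2
      omega
  have hker : LinearMap.ker Λ = (Ideal.span (range f)).restrictScalars ℝ := by
    apply le_antisymm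
    · intro g hg
      obtain ⟨h, rfl⟩ := Ψ.surjective g
      have hg' : co h = 0 := by
        have : co (Ψ.symm (Ψ h)) = 0 := hg
        rwa [Ψ.symm_apply_apply] at this
      rw [Submodule.restrictScalars_mem]
      change Φ h ∈ _
      rw [h.as_sum, map_sum]
      refine Submodule.sum_mem _ fun γ hγ => ?_
      rw [← mul_one (coeff γ h), ← smul_eq_mul, ← smul_monomial, map_smul, hΦm]
      refine Submodule.smul_of_tower_mem _ _ ?_
      have : ∃ i, d ≤ γ i := by
        by_contra! hlt
        rw [mem_support_iff] at hγ
        apply hγ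
        have h1 : co h (fun i => ⟨γ i, hlt i⟩) = 0 := by rw [hg', Pi.zero_apply]
        rw [hco] at h1
        rw [← h1]
        congr 1
        exact Finsupp.ext fun i => rfl
      obtain ⟨i, hi⟩ := this
      rw [← tsub_add_cancel_of_le (Finsupp.single_le_iff.2 hi), mixedProd_add_single hd]
      exact Ideal.mul_mem_right _ _ (Ideal.subset_span ⟨i, rfl⟩)
    · intro g hg
      rw [Submodule.restrictScalars_mem] at hg
      suffices h1 : ∀ h, Λ (g * h) = 0 by simpa using h1 1
      refine Submodule.span_induction (p := fun g _ => ∀ h, Λ (g * h) = 0) ?_ ?_ ?_ ?_ hg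
      · rintro _ ⟨i, rfl⟩ h
        exact hΛf h i
      · intro h
        rw [zero_mul, map_zero]
      · intro x y _ _ hx hy h
        rw [add_mul, map_add, hx, hy, add_zero]
      · intro a x _ hx h
        rw [smul_eq_mul, mul_assoc, mul_left_comm]
        exact hx _
  have e1 := LinearMap.quotKerEquivOfSurjective Λ hsurj
  rw [hker] at e1
  rw [((Submodule.Quotient.restrictScalarsEquiv ℝ (Ideal.span (range f))).symm.trans e1).finrank_eq]
  simp

/-- A system of as many polynomials as variables, all of degree at most `d` with `d` odd, has a
real zero after an arbitrarily small perturbation by the `X_i ^ d`. -/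
theorem exists_eval_eq_zero_of_odd {d : ℕ} (hd : Odd d) {q : σ → MvPolynomial σ ℝ}
    (hq : ∀ i, (q i).totalDegree ≤ d) {η : ℝ} (hη : 0 < η) :
    ∃ δ, 0 < δ ∧ δ < η ∧ ∃ x : σ → ℝ, ∀ i, δ * x i ^ d + eval x (q i) = 0 := by
  obtain ⟨δ, h0, h1, hsurj⟩ := exists_smul_add_substStep_surjective hq (Fintype.card σ * d + 1) hη
  refine ⟨δ, h0, h1, ?_⟩
  have hdeg : ∀ i, (C δ * X i ^ d + q i).totalDegree ≤ d := fun i => by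
    refine (totalDegree_add _ _).trans (max_le ((totalDegree_mul _ _).trans ?_) (hq i))
    rw [totalDegree_C, totalDegree_X_pow, zero_add]
  have hbij := bijective_constr_mixedProd hdeg
    (restrictTotalDegree_le_span_mixedProd hd.pos hsurj)
  obtain ⟨x, hx⟩ := exists_common_zero_of_odd_finrank
    (by rw [finrank_quotient_span_of_bijective hd.pos hbij]; exact hd.pow)
  exact ⟨x, fun i => by simpa using hx i⟩

end MvPolynomial

/-! ### The Borsuk–Ulam theorem -/

namespace MvPolynomial

variable {σ : Type*} [Fintype σ]

theorem totalDegree_one_add_sum_sq_pow_mul_prod_le (γ : Option σ →₀ ℕ) (m : ℕ) :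
    ((1 + ∑ j : σ, (X j : MvPolynomial σ ℝ) ^ 2) ^ m * ∏ j, X j ^ γ (some j)).totalDegree ≤
      2 * m + γ.degree := by
  refine (totalDegree_mul _ _).trans (add_le_add ?_ ?_)
  · refine (totalDegree_pow _ _).trans ?_
    rw [mul_comm]
    refine Nat.mul_le_mul_right _ ((totalDegree_add _ _).trans (max_le (by simp) ?_))
    exact totalDegree_finsetSum_le fun j _ => by rw [totalDegree_X_pow]
  · refine (totalDegree_finsetProd _ _).trans ?_
    rw [Finsupp.degree_eq_sum, Fintype.sum_option]
    refine le_add_left (Finset.sum_le_sum fun j _ => ?_)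
    rw [totalDegree_X_pow]

/-- The odd part of `p` on the unit sphere, in the affine chart `x ↦ r⁻¹ (1, x)` with
`r² = 1 + |x|²`, becomes a polynomial after multiplication by `r ^ d`, because a monomial of odd
degree at most `d` is left with an even power of `r`. -/
theorem exists_eval_eq_pow_mul_odd_part {d : ℕ} (hd : Odd d) (p : MvPolynomial (Option σ) ℝ)
    (hp : p.totalDegree ≤ d) :
    ∃ f : MvPolynomial σ ℝ, f.totalDegree ≤ d ∧
      ∀ (x : σ → ℝ) (r : ℝ), 0 < r → r ^ 2 = 1 + ∑ j, x j ^ 2 →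
        eval x f = r ^ d * ((eval (r⁻¹ • fun o => Option.elim o 1 x) p -
          eval (-(r⁻¹ • fun o => Option.elim o 1 x)) p) / 2) := by
  have hmono : ∀ γ : Option σ →₀ ℕ, γ.degree ≤ d → ∀ a : ℝ,
      ∃ f : MvPolynomial σ ℝ, f.totalDegree ≤ d ∧
      ∀ (x : σ → ℝ) (r : ℝ), 0 < r → r ^ 2 = 1 + ∑ j, x j ^ 2 →
        eval x f = r ^ d * ((eval (r⁻¹ • fun o => Option.elim o 1 x) (monomial γ a) -
          eval (-(r⁻¹ • fun o => Option.elim o 1 x)) (monomial γ a)) / 2) := by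
    intro γ hγ a
    have hneg : ∀ y : Option σ → ℝ,
        eval (-y) (monomial γ a) = (-1) ^ γ.degree * eval y (monomial γ a) := by
      intro y
      rw [eval_monomial, eval_monomial, Finsupp.prod_fintype _ _ (by simp),
        Finsupp.prod_fintype _ _ (by simp), Finsupp.degree_eq_sum,
        ← Finset.prod_pow_eq_pow_sum, mul_left_comm, ← Finset.prod_mul_distrib]
      congr 1
      refine Finset.prod_congr rfl fun o _ => ?_
      rw [Pi.neg_apply, neg_pow]
    rcases Nat.even_or_odd γ.degree with he | ho
    · refine ⟨0, by simp, fun x r _ _ => ?_⟩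
      rw [hneg, he.neg_one_pow]
      simp
    · obtain ⟨m, hm⟩ : Even (d - γ.degree) := Nat.Odd.sub_odd hd ho
      refine ⟨C a * ((1 + ∑ j : σ, X j ^ 2) ^ m * ∏ j, X j ^ γ (some j)), ?_, ?_⟩
      · refine (totalDegree_mul _ _).trans ?_
        have := totalDegree_one_add_sum_sq_pow_mul_prod_le γ m
        rw [totalDegree_C]
        omega
      · intro x r hr hr2
        rw [hneg, ho.neg_one_pow, eval_monomial, Finsupp.prod_fintype _ _ (by simp)]
        have hprod : ∏ o, (r⁻¹ • fun o => Option.elim o 1 x) o ^ γ o =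
            (r ^ γ.degree)⁻¹ * ∏ j, x j ^ γ (some j) := by
          simp only [Pi.smul_apply, smul_eq_mul, mul_pow, Finset.prod_mul_distrib]
          congr 1
          · rw [Finsupp.degree_eq_sum, Finset.prod_pow_eq_pow_sum, inv_pow]
          · rw [Fintype.prod_option]
            simp
        have hd' : r ^ d = (1 + ∑ j, x j ^ 2) ^ m * r ^ γ.degree := by
          rw [← hr2, ← pow_mul, ← pow_add]
          congr 1
          omega
        rw [hprod, hd']
        have : r ^ γ.degree ≠ 0 := (pow_pos hr _).ne'
        simp only [map_mul, map_pow, map_add, map_one, map_sum, map_prod, eval_C, eval_X]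
        field_simp
        ring
  choose! F hF1 hF2 using hmono
  refine ⟨∑ γ ∈ p.support, F γ (coeff γ p), ?_, ?_⟩
  · exact totalDegree_finsetSum_le fun γ hγ => hF1 γ ((le_totalDegree hγ).trans hp) _
  · intro x r hr hr2
    conv_rhs => rw [p.as_sum]
    rw [map_sum, map_sum, map_sum, ← Finset.sum_sub_distrib, Finset.sum_div, Finset.mul_sum]
    exact Finset.sum_congr rfl fun γ hγ =>
      hF2 γ ((le_totalDegree hγ).trans hp) _ x r hr hr2

theorem exists_forall_abs_eval_sub_lt {ι : Type*} {S : Set (ι → ℝ)}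
    (hS : IsCompact S) {g : (ι → ℝ) → ℝ} (hg : ContinuousOn g S) {ε : ℝ} (hε : 0 < ε) :
    ∃ p : MvPolynomial ι ℝ, ∀ y ∈ S, |eval y p - g y| < ε := by
  have : CompactSpace S := isCompact_iff_compactSpace.1 hS
  let coord : ι → C(S, ℝ) := fun i => 
    ⟨fun y => y.1 i, (continuous_apply i).comp continuous_subtype_val⟩
  have hev : ∀ (p : MvPolynomial ι ℝ) (y : S), aeval coord p y = eval y.1 p := by
    intro p y
    induction p using MvPolynomial.induction_on with
    | C a => simp
    | add p q hp hq => simp [hp, hq]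
    | mul_X p i hp => simp [hp, coord]
  obtain ⟨⟨_, ⟨p, rfl⟩⟩, hp⟩ :=
    ContinuousMap.exists_mem_subalgebra_near_continuous_of_separatesPoints
      (aeval (R := ℝ) coord).range (by
        intro x y hxy
        obtain ⟨i, hi⟩ : ∃ i, x.1 i ≠ y.1 i := by
          by_contra! h
          exact hxy (Subtype.ext (_root_.funext h))
        exact ⟨coord i, ⟨coord i, ⟨X i, by simp⟩, rfl⟩, hi⟩)
      (S.domRestrict g) hg.domRestrict ε hε
  refine ⟨p, fun y hy => ?_⟩
  have := hp ⟨y, hy⟩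
  rwa [← hev p ⟨y, hy⟩]

end MvPolynomial

open MvPolynomial in
/-- The Borsuk–Ulam theorem, for an odd map into a space of one dimension less that is continuous
away from the origin. -/
theorem exists_ne_zero_eq_zero_of_odd {σ : Type*} [Fintype σ]
    {g : (Option σ → ℝ) → σ → ℝ} (hg : ContinuousOn g {0}ᶜ) (hodd : ∀ y, g (-y) = -g y) :
    ∃ y, y ≠ 0 ∧ g y = 0 := by
  set S : Set (Option σ → ℝ) := {y | ∑ o, y o ^ 2 = 1} with hSdef
  have hS0 : S ⊆ {0}ᶜ := by
    rintro y hy rfl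
    simp [hSdef] at hy
  have hle : ∀ y ∈ S, ∀ o, |y o| ≤ 1 := by
    intro y hy o
    rw [← sq_le_one_iff_abs_le_one, ← show ∑ o, y o ^ 2 = 1 from hy]
    exact Finset.single_le_sum (f := fun o => y o ^ 2) (fun _ _ => sq_nonneg _) (Finset.mem_univ o)
  have hScomp : IsCompact S := by
    refine Metric.isCompact_of_isClosed_isBounded ?_ ?_
    · exact isClosed_eq (by fun_prop) continuous_const
    · refine (Metric.isBounded_closedBall (x := (0 : Option σ → ℝ)) (r := 1)).subset fun y hy => ?_
      rw [mem_closedBall_zero_iff, pi_norm_le_iff_of_nonneg zero_le_one]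
      exact hle y hy
  have hSne : S.Nonempty := by
    refine ⟨fun o => Option.elim o 1 0, ?_⟩
    simp [hSdef, Fintype.sum_option]
  have hgS : ContinuousOn g S := hg.mono hS0
  suffices happ : ∀ ε > 0, ∃ y ∈ S, ‖g y‖ ≤ ε by
    obtain ⟨y, hy, hmin⟩ := hScomp.exists_isMinOn hSne hgS.norm
    refine ⟨y, hS0 hy, ?_⟩
    rw [← norm_le_zero_iff]
    refine le_of_forall_pos_le_add fun ε hε => ?_
    obtain ⟨z, hz, hzε⟩ := happ ε hε
    rw [zero_add]
    exact (hmin hz).trans hzε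
  intro ε hε
  have hp : ∀ i, ∃ p : MvPolynomial (Option σ) ℝ, ∀ y ∈ S, |eval y p - g y i| < ε / 2 :=
    fun i => exists_forall_abs_eval_sub_lt hScomp
      ((continuous_apply i).comp_continuousOn hgS) (half_pos hε)
  choose p hp using hp
  set d := 2 * (Finset.univ.sup fun i => (p i).totalDegree) + 1 with hd
  have hdeg : ∀ i, (p i).totalDegree ≤ d := fun i => by
    have := Finset.le_sup (f := fun i => (p i).totalDegree) (Finset.mem_univ i)
    omega
  have hdodd : Odd d := odd_two_mul_add_one _
  choose f hf1 hf2 using fun i => exists_eval_eq_pow_mul_odd_part hdodd (p i) (hdeg i)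
  obtain ⟨δ, hδ, hδε, x, hx⟩ := exists_eval_eq_zero_of_odd hdodd hf1 (half_pos hε)
  have hpos : 0 < 1 + ∑ j, x j ^ 2 := by positivity
  set r := Real.sqrt (1 + ∑ j, x j ^ 2) with hr
  have hr0 : 0 < r := Real.sqrt_pos.2 hpos
  have hr2 : r ^ 2 = 1 + ∑ j, x j ^ 2 := Real.sq_sqrt hpos.le
  set y : Option σ → ℝ := r⁻¹ • fun o => Option.elim o 1 x with hy
  have hyS : y ∈ S := by
    change ∑ o, y o ^ 2 = 1
    simp only [hy, Pi.smul_apply, smul_eq_mul, mul_pow, ← Finset.mul_sum, Fintype.sum_option,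
      Option.elim_none, Option.elim_some, one_pow]
    rw [← hr2, ← mul_pow, inv_mul_cancel₀ hr0.ne', one_pow]
  have hnyS : -y ∈ S := by
    simpa [hSdef] using hyS
  refine ⟨y, hyS, (pi_norm_le_iff_of_nonneg hε.le).2 fun i => ?_⟩
  set w := (eval y (p i) - eval (-y) (p i)) / 2 with hw
  have hwg : |w - g y i| < ε / 2 := by
    have h1 := abs_lt.1 (hp i y hyS)
    have h2 := abs_lt.1 (hp i (-y) hnyS)
    rw [hodd, Pi.neg_apply] at h2
    rw [abs_lt]
    constructor <;> linarith [h1.1, h1.2, h2.1, h2.2]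
  have hwδ : |w| ≤ δ := by
    have h1 := hx i
    rw [hf2 i x r hr0 hr2] at h1
    have h2 : w = -(δ * y (some i) ^ d) := by
      have : y (some i) = x i / r := by
        simp [hy, div_eq_inv_mul]
      rw [this, div_pow, hw]
      have : r ^ d ≠ 0 := (pow_pos hr0 _).ne'
      field_simp
      linarith
    rw [h2, abs_neg, abs_mul, abs_of_pos hδ, abs_pow]
    exact mul_le_of_le_one_right hδ.le (pow_le_one₀ (abs_nonneg _) (hle y hyS _))
  rw [Real.norm_eq_abs]
  have := abs_sub_abs_le_abs_sub (g y i) w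
  rw [abs_sub_comm] at this
  linarith

namespace SchrodingerBroad

open Filter Topology

/-! ### Polynomials on space-time -/

section PolyEval

variable {n : ℕ}

theorem continuous_elim_coords :
    Continuous fun z : SpaceTime n => (Sum.elim z.1.ofLp fun _ => z.2 : Fin n ⊕ Unit → ℝ) := by
  refine continuous_pi fun i => ?_
  rcases i with i | i
  · simp only [Sum.elim_inl]
    fun_prop
  · simp only [Sum.elim_inr]
    fun_prop

theorem continuous_polyEval (P : MvPolynomial (Fin n ⊕ Unit) ℝ) : Continuous (polyEval P) :=
  (MvPolynomial.continuous_eval P).comp continuous_elim_coords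

theorem polyEval_mul (P Q : MvPolynomial (Fin n ⊕ Unit) ℝ) (z : SpaceTime n) :
    polyEval (P * Q) z = polyEval P z * polyEval Q z :=
  map_mul _ _ _

theorem polyEval_neg (P : MvPolynomial (Fin n ⊕ Unit) ℝ) (z : SpaceTime n) :
    polyEval (-P) z = -polyEval P z :=
  map_neg _ _

theorem exists_polyEval_ne_zero {P : MvPolynomial (Fin n ⊕ Unit) ℝ} (hP : P ≠ 0) :
    ∃ z, polyEval P z ≠ 0 := by
  by_contra! h
  apply hP
  refine MvPolynomial.funext fun v => ?_
  rw [map_zero, ← h (WithLp.toLp 2 fun i => v (Sum.inl i), v (Sum.inr ()))]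
  unfold polyEval
  congr 1
  congr 1
  funext i
  rcases i with i | i <;> rfl

theorem exists_polynomial_eval_eq_polyEval_add_smul (P : MvPolynomial (Fin n ⊕ Unit) ℝ)
    (a v : SpaceTime n) :
    ∃ Q : Polynomial ℝ, ∀ t, Q.eval t = polyEval P (t • v + a) := by
  let coords : SpaceTime n → Fin n ⊕ Unit → ℝ := fun z => Sum.elim z.1.ofLp fun _ => z.2
  refine ⟨MvPolynomial.aeval
    (fun i => Polynomial.X * Polynomial.C (coords v i) + Polynomial.C (coords a i)) P, fun t => ?_⟩
  induction P using MvPolynomial.induction_on with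
  | C c => simp [polyEval]
  | add P Q hP hQ => rw [map_add, Polynomial.eval_add, hP, hQ]; exact (map_add _ _ _).symm
  | mul_X P i hP =>
    rw [map_mul, Polynomial.eval_mul, hP, polyEval_mul]
    congr 1
    rcases i with i | i <;> (simp [polyEval, coords]; ring)

instance : (volume : Measure (SpaceTime n)).IsAddHaarMeasure :=
  inferInstanceAs ((volume : Measure (Space n)).prod (volume : Measure ℝ)).IsAddHaarMeasure

/-- From a point off the zero set, almost every point of every ray lies off the zero set; hence
so does almost every point of some dilate of space-time about that point. -/
theorem volume_zeroSet {P : MvPolynomial (Fin n ⊕ Unit) ℝ} (hP : P ≠ 0) :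
    volume (zeroSet P) = 0 := by
  obtain ⟨a, ha⟩ := exists_polyEval_ne_zero hP
  have hmeas : MeasurableSet {w : SpaceTime n × ℝ | polyEval P (w.2 • (w.1 - a) + a) ≠ 0} := by
    have hc : Continuous fun w : SpaceTime n × ℝ => polyEval P (w.2 • (w.1 - a) + a) :=
      (continuous_polyEval P).comp (by fun_prop)
    exact (isOpen_ne.preimage hc).measurableSet
  have hray : ∀ᵐ x : SpaceTime n, ∀ᵐ t : ℝ, polyEval P (t • (x - a) + a) ≠ 0 := by
    refine Eventually.of_forall fun x => ?_
    obtain ⟨Q, hQ⟩ := exists_polynomial_eval_eq_polyEval_add_smul P a (x - a)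
    have hQ0 : Q ≠ 0 := by
      rintro rfl
      have := hQ 0
      rw [zero_smul, zero_add, Polynomial.eval_zero] at this
      exact ha this.symm
    rw [ae_iff]
    refine Set.Finite.measure_zero ((Polynomial.finite_setOfPred_isRoot hQ0).subset fun t ht => ?_) _
    simp only [mem_ofPred_eq, not_not] at ht
    exact (hQ t).trans ht
  obtain ⟨t, ht, ht0⟩ := (((Measure.ae_ae_comm hmeas).1 hray).and (volume.ae_ne (0 : ℝ))).exists
  rw [ae_iff] at ht
  have himage : zeroSet P ⊆ AffineMap.homothety a t ''
      {x | ¬ polyEval P (t • (x - a) + a) ≠ 0} := by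
    intro z hz
    have hz' : t • (t⁻¹ • (z - a) + a - a) + a = z := by
      rw [add_sub_cancel_right, smul_inv_smul₀ ht0, sub_add_cancel]
    refine ⟨t⁻¹ • (z - a) + a, ?_, ?_⟩
    · rw [mem_ofPred_eq, hz', not_not]
      exact hz
    · rw [AffineMap.homothety_apply]
      exact hz'
  refine measure_mono_null himage ?_
  rw [Measure.addHaar_image_homothety, ht, mul_zero]

/-- The open set where a polynomial is positive. -/
def posSet (P : MvPolynomial (Fin n ⊕ Unit) ℝ) : Set (SpaceTime n) :=
  {z | 0 < polyEval P z}

theorem isOpen_posSet (P : MvPolynomial (Fin n ⊕ Unit) ℝ) : IsOpen (posSet P) :=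
  isOpen_lt continuous_const (continuous_polyEval P)

theorem mem_posSet_neg {P : MvPolynomial (Fin n ⊕ Unit) ℝ} {z : SpaceTime n} :
    z ∈ posSet (-P) ↔ polyEval P z < 0 := by
  rw [posSet, mem_ofPred_eq, polyEval_neg, neg_pos]

theorem posSet_union_posSet_neg (P : MvPolynomial (Fin n ⊕ Unit) ℝ) :
    posSet P ∪ posSet (-P) = (zeroSet P)ᶜ := by
  ext z
  rw [mem_union, mem_posSet_neg]
  exact or_comm.trans lt_or_lt_iff_ne

theorem disjoint_posSet_posSet_neg (P : MvPolynomial (Fin n ⊕ Unit) ℝ) :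
    Disjoint (posSet P) (posSet (-P)) := by
  rw [Set.disjoint_left]
  intro z h1 h2
  rw [mem_posSet_neg] at h2
  exact lt_asymm h1 h2

end PolyEval

/-! ### Mixed norms of sets -/

section MixedNorm

variable {Ω : Type*} [MeasurableSpace Ω] {N₁ N₂ : ℕ}

/-- The `ℓ¹(ℓ^r)` norm of the family of masses `ν b m O`. -/
noncomputable def mixedNorm (r : ℝ) (ν : Fin N₁ → Fin N₂ → Measure Ω) (O : Set Ω) : ℝ≥0∞ :=
  ∑ b, (∑ m, ν b m O ^ r) ^ (1 / r)

theorem mixedNorm_union_le {r : ℝ} (hr : 1 ≤ r) (ν : Fin N₁ → Fin N₂ → Measure Ω)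
    (O O' : Set Ω) : mixedNorm r ν (O ∪ O') ≤ mixedNorm r ν O + mixedNorm r ν O' := by
  have hr0 : 0 ≤ r := zero_le_one.trans hr
  unfold mixedNorm
  rw [← Finset.sum_add_distrib]
  refine Finset.sum_le_sum fun b _ => le_trans ?_ (ENNReal.Lp_add_le _ _ _ hr)
  gcongr
  exact measure_union_le _ _

theorem mixedNorm_empty {r : ℝ} (hr : 0 < r) (ν : Fin N₁ → Fin N₂ → Measure Ω) :
    mixedNorm r ν ∅ = 0 := by
  simp [mixedNorm, hr]

theorem mixedNorm_ne_top {r : ℝ} (hr : 0 ≤ r) (ν : Fin N₁ → Fin N₂ → Measure Ω)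
    [∀ b m, IsFiniteMeasure (ν b m)] (O : Set Ω) : mixedNorm r ν O ≠ ∞ := by
  refine ENNReal.sum_ne_top.2 fun b _ => ENNReal.rpow_ne_top_of_nonneg (by positivity) ?_
  exact ENNReal.sum_ne_top.2 fun m _ => ENNReal.rpow_ne_top_of_nonneg hr (measure_ne_top _ _)

theorem mixedNorm_congr_ae {μ : Measure Ω} (r : ℝ) {ν : Fin N₁ → Fin N₂ → Measure Ω}
    (hν : ∀ b m, ν b m ≪ μ) {O O' : Set Ω} (h : O =ᵐ[μ] O') :
    mixedNorm r ν O = mixedNorm r ν O' := by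
  unfold mixedNorm
  refine Finset.sum_congr rfl fun b _ => ?_
  congr 1
  refine Finset.sum_congr rfl fun m _ => ?_
  rw [measure_congr ((hν b m).ae_eq h)]

theorem tendsto_mixedNorm {ι : Type*} {L : Filter ι} [L.IsCountablyGenerated] {r : ℝ}
    {ν : Fin N₁ → Fin N₂ → Measure Ω} [∀ b m, IsFiniteMeasure (ν b m)] {O : ι → Set Ω}
    {O' : Set Ω} (hO : ∀ i, MeasurableSet (O i)) (hO' : MeasurableSet O')
    (h : ∀ b m, ∀ᵐ x ∂ν b m, ∀ᶠ i in L, x ∈ O i ↔ x ∈ O') :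
    Tendsto (fun i => mixedNorm r ν (O i)) L (𝓝 (mixedNorm r ν O')) := by
  refine tendsto_finsetSum _ fun b _ => ?_
  refine (ENNReal.continuous_rpow_const.tendsto _).comp ?_
  refine tendsto_finsetSum _ fun m _ => ?_
  refine (ENNReal.continuous_rpow_const.tendsto _).comp ?_
  exact tendsto_measure_of_ae_tendsto_indicator_of_isFiniteMeasure L hO' hO (h b m)

end MixedNorm

/-! ### Polynomial ham sandwich and partitioning -/

section Partition

variable {n N₁ N₂ : ℕ} {r : ℝ} {ν : Fin N₁ → Fin N₂ → Measure (SpaceTime n)}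

theorem tendsto_mixedNorm_inter_posSet [∀ b m, IsFiniteMeasure (ν b m)]
    (hν : ∀ b m, ν b m ≪ volume) {ι : Type*} {L : Filter ι} [L.IsCountablyGenerated]
    {Q : ι → MvPolynomial (Fin n ⊕ Unit) ℝ} {Q' : MvPolynomial (Fin n ⊕ Unit) ℝ} (hQ' : Q' ≠ 0)
    (hQ : ∀ z, Tendsto (fun i => polyEval (Q i) z) L (𝓝 (polyEval Q' z)))
    {O : Set (SpaceTime n)} (hO : MeasurableSet O) :
    Tendsto (fun i => mixedNorm r ν (O ∩ posSet (Q i))) L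
      (𝓝 (mixedNorm r ν (O ∩ posSet Q'))) := by
  refine tendsto_mixedNorm (fun i => hO.inter (isOpen_posSet _).measurableSet)
    (hO.inter (isOpen_posSet _).measurableSet) fun b m => ?_
  have hae : ∀ᵐ z ∂ν b m, polyEval Q' z ≠ 0 := by
    rw [ae_iff]
    refine hν b m ?_
    simpa [zeroSet] using volume_zeroSet hQ'
  filter_upwards [hae] with z hz
  rcases hz.lt_or_gt with h | h
  · filter_upwards [(hQ z).eventually (gt_mem_nhds h)] with i hi
    simp [posSet, h.not_gt, (show polyEval (Q i) z < 0 from hi).not_gt]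
  · filter_upwards [(hQ z).eventually (lt_mem_nhds h)] with i hi
    simp [posSet, h, show 0 < polyEval (Q i) z from hi]

/-- Polynomial ham sandwich for mixed norms: with one more monomial than there are sets, some
combination of the monomials bisects all the sets. -/
theorem exists_mixedNorm_inter_posSet_eq (hr : 0 ≤ r) [∀ b m, IsFiniteMeasure (ν b m)]
    (hν : ∀ b m, ν b m ≪ volume) {ι : Type*} [Fintype ι] {O : ι → Set (SpaceTime n)}
    (hO : ∀ i, MeasurableSet (O i)) {γ : Option ι → (Fin n ⊕ Unit →₀ ℕ)}
    (hγ : Function.Injective γ) {e : ℕ} (hdeg : ∀ o, (γ o).degree ≤ e) :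
    ∃ Q : MvPolynomial (Fin n ⊕ Unit) ℝ, Q ≠ 0 ∧ Q.totalDegree ≤ e ∧
      ∀ i, mixedNorm r ν (O i ∩ posSet Q) = mixedNorm r ν (O i ∩ posSet (-Q)) := by
  let Q : (Option ι → ℝ) → MvPolynomial (Fin n ⊕ Unit) ℝ :=
    fun y => ∑ o, MvPolynomial.monomial (γ o) (y o)
  have hQne : ∀ y, y ≠ 0 → Q y ≠ 0 := by
    classical
    intro y hy h
    apply hy
    funext o
    have := congrArg (MvPolynomial.coeff (γ o)) h
    simpa only [Q, MvPolynomial.coeff_sum, MvPolynomial.coeff_monomial, hγ.eq_iff,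
      Finset.sum_ite_eq', Finset.mem_univ, if_true, MvPolynomial.coeff_zero,
      Pi.zero_apply] using this
  have hQneg : ∀ y, Q (-y) = -Q y := by
    intro y
    simp only [Q, Pi.neg_apply, map_neg, Finset.sum_neg_distrib]
  have hQcont : ∀ z, Continuous fun y => polyEval (Q y) z := by
    intro z
    simp only [Q, polyEval, map_sum, MvPolynomial.eval_monomial]
    fun_prop
  let g : (Option ι → ℝ) → ι → ℝ := fun y i =>
    (mixedNorm r ν (O i ∩ posSet (Q y))).toReal - (mixedNorm r ν (O i ∩ posSet (-Q y))).toReal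
  obtain ⟨y, hy0, hy⟩ := exists_ne_zero_eq_zero_of_odd (g := g) (by
      intro y hy
      refine ContinuousAt.continuousWithinAt (continuousAt_pi.2 fun i => ?_)
      refine Tendsto.sub ?_ ?_
      · refine (ENNReal.tendsto_toReal (mixedNorm_ne_top hr ν _)).comp ?_
        exact tendsto_mixedNorm_inter_posSet hν (hQne y hy) (fun z => (hQcont z).tendsto y) (hO i)
      · refine (ENNReal.tendsto_toReal (mixedNorm_ne_top hr ν _)).comp ?_
        refine tendsto_mixedNorm_inter_posSet hν (neg_ne_zero.2 (hQne y hy)) (fun z => ?_) (hO i)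
        simp only [polyEval_neg]
        exact ((hQcont z).tendsto y).neg) (by
      intro y
      funext i
      simp only [g, hQneg, neg_neg, Pi.neg_apply, neg_sub])
  refine ⟨Q y, hQne y hy0, ?_, fun i => ?_⟩
  · refine MvPolynomial.totalDegree_finsetSum_le fun o _ => ?_
    exact (MvPolynomial.totalDegree_monomial_le _ _).trans (hdeg o)
  · have := congrFun hy i
    exact (ENNReal.toReal_eq_toReal_iff' (mixedNorm_ne_top hr ν _) (mixedNorm_ne_top hr ν _)).1
      (sub_eq_zero.1 this)

theorem exists_injective_exponents (n q : ℕ) {ι : Type*} [Fintype ι]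
    (hι : Fintype.card ι ≤ (2 ^ q) ^ (n + 1)) :
    ∃ γ : ι → (Fin n ⊕ Unit →₀ ℕ), Function.Injective γ ∧
      ∀ o, (γ o).degree ≤ (n + 1) * 2 ^ q := by
  obtain ⟨φ⟩ : Nonempty (ι ↪ (Fin n ⊕ Unit → Fin (2 ^ q))) :=
    Function.Embedding.nonempty_of_card_le (by simpa using hι)
  refine ⟨fun o => Finsupp.equivFunOnFinite.symm fun i => (φ o i : ℕ), ?_, fun o => ?_⟩
  · intro o o' h
    apply φ.injective
    funext i
    exact Fin.ext (congrFun (Finsupp.equivFunOnFinite.symm.injective h) i)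
  · rw [Finsupp.degree_eq_sum]
    refine (Finset.sum_le_card_nsmul _ _ (2 ^ q) fun i _ => (φ o i).2.le).trans ?_
    simp

/-- Iterated bisection: the `j`-th step bisects `2 ^ j` cells by a polynomial whose exponents are
below `2 ^ (j / (n + 1) + 1)`. By the triangle inequality for the mixed norm, each half carries
at least half of the norm of the cell. -/
theorem exists_partition_two_pow (hr : 1 ≤ r) [∀ b m, IsFiniteMeasure (ν b m)]
    (hν : ∀ b m, ν b m ≪ volume) (J : ℕ) :
    ∃ P : MvPolynomial (Fin n ⊕ Unit) ℝ, P ≠ 0 ∧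
      P.totalDegree ≤ ∑ j ∈ Finset.range J, (n + 1) * 2 ^ (j / (n + 1) + 1) ∧
      ∃ O : Fin (2 ^ J) → Set (SpaceTime n), (∀ i, IsOpen (O i)) ∧
        (Pairwise fun i j => Disjoint (O i) (O j)) ∧ ⋃ i, O i = (zeroSet P)ᶜ ∧
        ∀ i, mixedNorm r ν univ ≤ 2 ^ J * mixedNorm r ν (O i) := by
  induction J with
  | zero =>
    refine ⟨1, one_ne_zero, by simp, fun _ => univ, fun _ => isOpen_univ, ?_, ?_, by simp⟩
    · intro i j hij
      exact absurd (Subsingleton.elim (α := Fin 1) i j) hij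
    · have : zeroSet (1 : MvPolynomial (Fin n ⊕ Unit) ℝ) = ∅ := by
        simp [zeroSet, polyEval]
      rw [this, compl_empty]
      exact iUnion_const (ι := Fin 1) univ
  | succ J ih =>
    obtain ⟨P, hP, hdeg, O, hopen, hdisj, hunion, hmass⟩ := ih
    obtain ⟨γ, hγ, hγdeg⟩ := exists_injective_exponents n (J / (n + 1) + 1)
      (ι := Option (Fin (2 ^ J))) (by
        rw [Fintype.card_option, Fintype.card_fin, ← pow_mul]
        have h1 : J + 1 ≤ (J / (n + 1) + 1) * (n + 1) := by
          have := Nat.lt_div_mul_add (a := J) (b := n + 1) (Nat.succ_pos n)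
          rw [add_mul, one_mul]
          omega
        have h2 : 2 ^ (J + 1) ≤ 2 ^ ((J / (n + 1) + 1) * (n + 1)) :=
          Nat.pow_le_pow_right two_pos h1
        have h3 : 1 ≤ 2 ^ J := Nat.one_le_two_pow
        rw [pow_succ] at h2
        omega)
    obtain ⟨Q, hQ, hQdeg, hbis⟩ := exists_mixedNorm_inter_posSet_eq (zero_le_one.trans hr) hν
      (fun i => (hopen i).measurableSet) hγ hγdeg
    let e : Fin (2 ^ (J + 1)) ≃ Fin (2 ^ J) × Bool :=
      Fintype.equivOfCardEq (by simp [pow_succ])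
    let half : Bool → Set (SpaceTime n) := fun s => posSet (if s then Q else -Q)
    have hhalf_disj : ∀ s s', s ≠ s' → Disjoint (half s) (half s') := by
      have := disjoint_posSet_posSet_neg Q
      rintro (_ | _) (_ | _) h
      · exact absurd rfl h
      · exact this.symm
      · exact this
      · exact absurd rfl h
    have hhalf_union : ⋃ s, half s = (zeroSet Q)ᶜ := by
      rw [← posSet_union_posSet_neg, union_eq_iUnion]
      exact iUnion_congr fun s => by cases s <;> rfl
    refine ⟨P * Q, mul_ne_zero hP hQ, ?_, fun k => O (e k).1 ∩ half (e k).2, ?_, ?_, ?_, ?_⟩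
    · rw [Finset.sum_range_succ]
      exact (MvPolynomial.totalDegree_mul _ _).trans (add_le_add hdeg hQdeg)
    · exact fun k => (hopen _).inter (isOpen_posSet _)
    · intro k l hkl
      by_cases h : (e k).1 = (e l).1
      · have h2 : (e k).2 ≠ (e l).2 := fun h2 => hkl (e.injective (Prod.ext h h2))
        exact (hhalf_disj _ _ h2).mono inter_subset_right inter_subset_right
      · exact (hdisj h).mono inter_subset_left inter_subset_left
    · have h1 : ⋃ k, O (e k).1 ∩ half (e k).2 = (⋃ i, O i) ∩ ⋃ s, half s := by
        ext z
        simp only [mem_iUnion, mem_inter_iff]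
        constructor
        · rintro ⟨k, h1, h2⟩
          exact ⟨⟨_, h1⟩, ⟨_, h2⟩⟩
        · rintro ⟨⟨i, h1⟩, ⟨s, h2⟩⟩
          exact ⟨e.symm (i, s), by simpa using h1, by simpa using h2⟩
      rw [h1, hunion, hhalf_union, ← compl_union]
      congr 1
      ext z
      simp only [zeroSet, mem_union, mem_ofPred_eq, polyEval_mul, mul_eq_zero]
    · intro k
      refine (hmass (e k).1).trans ?_
      have hae : O (e k).1 =ᵐ[volume]
          ((O (e k).1 ∩ posSet Q) ∪ (O (e k).1 ∩ posSet (-Q)) : Set (SpaceTime n)) := by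
        rw [← inter_union_distrib_left, posSet_union_posSet_neg]
        have hz : ((zeroSet Q)ᶜ : Set (SpaceTime n)) =ᵐ[volume] univ := by
          rw [ae_eq_univ, compl_compl]
          exact volume_zeroSet hQ
        simpa using ((ae_eq_refl (O (e k).1)).inter hz).symm
      have heq : mixedNorm r ν (O (e k).1 ∩ half (e k).2) =
          mixedNorm r ν (O (e k).1 ∩ posSet Q) := by
        rcases (e k).2
        · exact (hbis _).symm
        · rfl
      have hle : mixedNorm r ν (O (e k).1) ≤ 2 * mixedNorm r ν (O (e k).1 ∩ half (e k).2) := by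
        rw [mixedNorm_congr_ae r hν hae]
        refine (mixedNorm_union_le hr ν _ _).trans ?_
        rw [← hbis, heq, two_mul]
      rw [pow_succ (2 : ℝ≥0∞), mul_assoc]
      gcongr

theorem sum_range_mul_two_pow_div (n T : ℕ) :
    ∑ j ∈ Finset.range ((n + 1) * T), (n + 1) * 2 ^ (j / (n + 1) + 1) + 2 * (n + 1) ^ 2 =
      2 * (n + 1) ^ 2 * 2 ^ T := by
  induction T with
  | zero => simp
  | succ T ih =>
    have h : ∀ j ∈ Finset.range (n + 1),
        (n + 1) * 2 ^ (((n + 1) * T + j) / (n + 1) + 1) = (n + 1) * 2 ^ (T + 1) := by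
      intro j hj
      rw [Nat.mul_add_div (Nat.succ_pos n), Nat.div_eq_of_lt (Finset.mem_range.1 hj), add_zero]
    rw [mul_add, mul_one, Finset.sum_range_add, Finset.sum_congr rfl h, Finset.sum_const,
      Finset.card_range, smul_eq_mul, add_right_comm, ih]
    ring

/-- Polynomial partitioning with `2 ^ (J := (n + 1) T)` cells, where `2 ^ T` is comparable to the
degree bound `D`. -/
theorem exists_partition_of_one_le (hr : 1 ≤ r) [∀ b m, IsFiniteMeasure (ν b m)]
    (hν : ∀ b m, ν b m ≪ volume) (hpos : mixedNorm r ν univ ≠ 0) {D : ℝ} (hD : 1 ≤ D) :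
    ∃ P : MvPolynomial (Fin n ⊕ Unit) ℝ, P ≠ 0 ∧ (P.totalDegree : ℝ) ≤ D ∧
      ∃ (L : ℕ) (O : Fin L → Set (SpaceTime n)),
        ((4 * ((n : ℝ) + 1) ^ 2) ^ (n + 1))⁻¹ * D ^ (n + 1) ≤ (L : ℝ) ∧ (L : ℝ) ≤ D ^ (n + 1) ∧
        (∀ i, IsOpen (O i)) ∧ (∀ i, (O i).Nonempty) ∧
        (Pairwise fun i j => Disjoint (O i) (O j)) ∧ ⋃ i, O i = (zeroSet P)ᶜ ∧
        ∀ i, mixedNorm r ν univ ≤ L * mixedNorm r ν (O i) := by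
  set a : ℝ := 2 * (n + 1) ^ 2 with ha
  have ha1 : 1 ≤ a := by
    have : (1 : ℝ) ≤ (n + 1) ^ 2 := one_le_pow₀ (by linarith [n.cast_nonneg (α := ℝ)])
    linarith
  -- `T = 0` gives the degree bound `0`, and is the only choice when `D` is small.
  obtain ⟨T, hT1, hT2, hT3⟩ : ∃ T : ℕ, a * 2 ^ T - a ≤ D ∧ D < 2 * a * 2 ^ T ∧ (2 : ℝ) ^ T ≤ D := by
    rcases lt_or_ge D a with h | h
    · exact ⟨0, by linarith, by linarith, by simpa using hD⟩
    · obtain ⟨T, h1, h2⟩ := exists_nat_pow_near ((one_le_div (by linarith)).2 h) one_lt_two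
      have hapos : 0 < a := by linarith
      rw [le_div_iff₀ hapos] at h1
      rw [div_lt_iff₀ hapos, pow_succ] at h2
      refine ⟨T, by linarith, by linarith, le_trans ?_ h1⟩
      exact le_mul_of_one_le_right (by positivity) ha1
  obtain ⟨P, hP, hdeg, O, hopen, hdisj, hunion, hmass⟩ :=
    exists_partition_two_pow (n := n) hr hν ((n + 1) * T)
  have hL : ((2 ^ ((n + 1) * T) : ℕ) : ℝ) = (2 ^ T) ^ (n + 1) := by
    push_cast
    rw [mul_comm, pow_mul]
  refine ⟨P, hP, ?_, 2 ^ ((n + 1) * T), O, ?_, ?_, hopen, ?_, hdisj, hunion, ?_⟩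
  · refine le_trans ?_ hT1
    have h1 := sum_range_mul_two_pow_div n T
    have h2 : P.totalDegree + 2 * (n + 1) ^ 2 ≤ 2 * (n + 1) ^ 2 * 2 ^ T := by omega
    have h3 : (P.totalDegree : ℝ) + 2 * (n + 1) ^ 2 ≤ 2 * (n + 1) ^ 2 * 2 ^ T := by
      exact_mod_cast h2
    linarith
  · rw [hL, inv_mul_le_iff₀ (by positivity), ← mul_pow]
    refine pow_le_pow_left₀ (by linarith) ?_ _
    rw [ha] at hT2
    linarith
  · rw [hL]
    exact pow_le_pow_left₀ (by positivity) hT3 _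
  · intro i
    by_contra h
    have h0 := hmass i
    rw [not_nonempty_iff_eq_empty.1 h, mixedNorm_empty (by linarith), mul_zero] at h0
    exact hpos (le_antisymm h0 bot_le)
  · intro i
    have := hmass i
    push_cast
    exact this

end Partition

end SchrodingerBroad

namespace SchrodingerBroad

/-! ### Finiteness of the broad mass -/

theorem norm_evolve_le {n : ℕ} (g : Space n → ℂ) (x : Space n) (t : ℝ) :
    ‖evolve g x t‖ ≤ ((2 * Real.pi) ^ n)⁻¹ * ∫ ξ, ‖g ξ‖ := by
  unfold evolve
  rw [norm_mul, Complex.norm_real, Real.norm_of_nonneg (by positivity)]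
  refine mul_le_mul_of_nonneg_left ((norm_integral_le_integral_norm _).trans_eq ?_) (by positivity)
  congr 1
  funext ξ
  rw [norm_mul, Complex.norm_exp_I_mul_ofReal, one_mul]

theorem exists_submodule_finrank_eq {V : Type*} [AddCommGroup V] [Module ℝ V]
    [FiniteDimensional ℝ V] {m : ℕ} (hm : m ≤ Module.finrank ℝ V) :
    ∃ W : Submodule ℝ V, Module.finrank ℝ W = m := by
  let b := Module.finBasis ℝ V
  refine ⟨Submodule.span ℝ (range (b ∘ Fin.castLE hm)), ?_⟩
  rw [finrank_span_eq_card (b.linearIndependent.comp _ (Fin.castLE_injective hm)),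
    Fintype.card_fin]

/-- The solution is bounded, since `f̂ 1_τ` is integrable (and if it were not, its evolution would
be zero by convention); the infimum is over a nonempty set because `k - 1 ≤ n + 1`. -/
theorem broadMass_ne_top {n N k A : ℕ} (hk : k ≤ n + 2) (K M : ℝ) {p : ℝ} (hp : 0 ≤ p)
    (τ : Fin N → Set (Space n)) (f : Lp ℂ 2 (volume : Measure (Space n)))
    {Q : Set (SpaceTime n)} (hQ : volume Q ≠ ∞) : broadMass k A K M p τ f Q ≠ ∞ := by
  obtain ⟨W, hW⟩ : ∃ W : Submodule ℝ (EuclideanSpaceTime n), Module.finrank ℝ W = k - 1 := by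
    apply exists_submodule_finrank_eq
    rw [(WithLp.linearEquiv 2 ℝ (Space n × ℝ)).finrank_eq]
    simp
    omega
  have hbound : ∀ j, ∫⁻ z in Q, ‖evolvePiece f (τ j) z.1 z.2‖ₑ ^ p ≠ ∞ := by
    intro j
    set c := ((2 * Real.pi) ^ n)⁻¹ * ∫ ξ, ‖(τ j).indicator (hat f) ξ‖
    have hle : ∫⁻ z in Q, ‖evolvePiece f (τ j) z.1 z.2‖ₑ ^ p ≤
        ∫⁻ _ in Q, ENNReal.ofReal c ^ p := by
      refine lintegral_mono fun z => ENNReal.rpow_le_rpow ?_ hp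
      rw [← ofReal_norm]
      exact ENNReal.ofReal_le_ofReal (norm_evolve_le _ _ _)
    refine ne_top_of_le_ne_top ?_ hle
    rw [setLIntegral_const]
    exact ENNReal.mul_ne_top (ENNReal.rpow_ne_top_of_nonneg hp ENNReal.ofReal_ne_top) hQ
  refine ne_top_of_le_ne_top ?_ (iInf_le _ fun _ => ⟨W, hW⟩)
  refine ne_top_of_le_ne_top (ENNReal.sum_ne_top.2 fun j (_ : j ∈ Finset.univ) => hbound j) ?_
  exact iSup_le fun j => Finset.single_le_sum
    (f := fun j => ∫⁻ z in Q, ‖evolvePiece f (τ j) z.1 z.2‖ₑ ^ p)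
    (fun _ _ => bot_le) (Finset.mem_univ j.1)

/-! ### The broad norm as a mixed norm -/

/-- The measure `O ↦ |O ∩ U ∩ Q| / |Q| · w`. -/
noncomputable def cellMeasure {n : ℕ} (U Q : Set (SpaceTime n)) (w : ℝ≥0∞) :
    Measure (SpaceTime n) :=
  (w / volume Q) • volume.restrict (U ∩ Q)

theorem cellMeasure_apply {n : ℕ} (U Q : Set (SpaceTime n)) (w : ℝ≥0∞) {O : Set (SpaceTime n)}
    (hO : MeasurableSet O) :
    cellMeasure U Q w O = volume (U ∩ O ∩ Q) / volume Q * w := by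
  rw [cellMeasure, Measure.smul_apply, Measure.restrict_apply hO, smul_eq_mul, inter_comm O,
    inter_right_comm, div_eq_mul_inv, div_eq_mul_inv]
  ring

theorem isFiniteMeasure_cellMeasure {n : ℕ} (U : Set (SpaceTime n)) {Q : Set (SpaceTime n)}
    {w : ℝ≥0∞} (hw : w ≠ ∞) : IsFiniteMeasure (cellMeasure U Q w) := by
  refine ⟨?_⟩
  rw [cellMeasure_apply U Q w MeasurableSet.univ]
  refine ENNReal.mul_lt_top (lt_of_le_of_lt ?_ ENNReal.one_lt_top) hw.lt_top
  exact (ENNReal.div_le_div_right (measure_mono inter_subset_right) _).trans ENNReal.div_self_le_one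

theorem cellMeasure_absolutelyContinuous {n : ℕ} (U Q : Set (SpaceTime n)) (w : ℝ≥0∞) :
    cellMeasure U Q w ≪ volume :=
  Measure.smul_absolutelyContinuous.trans Measure.absolutelyContinuous_restrict

theorem broadNormPow_inter_eq_mixedNorm {n N N₁ N₂ : ℕ} (k A : ℕ) (K M p r : ℝ)
    (τ : Fin N → Set (Space n)) (B : Fin N₁ → Set (Space n)) (I : Fin N₂ → Set ℝ)
    (f : Lp ℂ 2 (volume : Measure (Space n))) (U : Set (SpaceTime n)) {O : Set (SpaceTime n)}
    (hO : MeasurableSet O) :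
    broadNormPow k A K M p r τ B I f (U ∩ O) =
      mixedNorm r (fun b m => cellMeasure U (B b ×ˢ I m)
        (broadMass k A K M p τ f (B b ×ˢ I m))) O := by
  simp only [broadNormPow, mixedNorm, cellMeasure_apply _ _ _ hO]

end SchrodingerBroad

open SchrodingerBroad in
theorem theorem4p2 (n : ℕ) (hn : 1 ≤ n) :
    ∃ c : ℝ, 0 < c ∧
      ∀ (k A : ℕ) (K M R p r : ℝ) (ξ₀ : SchrodingerBroad.Space n),
        2 ≤ k → k ≤ n + 2 → 0 < K → 1 ≤ M → 0 < R → 1 ≤ p → 1 ≤ r → ‖ξ₀‖ ≤ 1 →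
      ∀ (N N₁ N₂ : ℕ) (τ : Fin N → Set (SchrodingerBroad.Space n))
        (B : Fin N₁ → Set (SchrodingerBroad.Space n)) (I : Fin N₂ → Set ℝ),
        SchrodingerBroad.IsBallDecomposition ξ₀ M⁻¹ (K * M)⁻¹ τ →
        SchrodingerBroad.IsBallDecomposition 0 R K B →
        SchrodingerBroad.IsIntervalDecomposition R K I →
      ∀ (f : Lp ℂ 2 (volume : Measure (SchrodingerBroad.Space n)))
        (U : Set (SchrodingerBroad.SpaceTime n)),
        SchrodingerBroad.FourierSupportedIn f ξ₀ M⁻¹ →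
        U ⊆ Metric.closedBall 0 R ×ˢ Icc 0 R →
      ∀ D : ℝ, 1 ≤ D →
        ∃ P : MvPolynomial (Fin n ⊕ Unit) ℝ, P ≠ 0 ∧ (P.totalDegree : ℝ) ≤ D ∧
          ∃ (L : ℕ) (O : Fin L → Set (SchrodingerBroad.SpaceTime n)),
            c⁻¹ * D ^ (n + 1) ≤ (L : ℝ) ∧ (L : ℝ) ≤ c * D ^ (n + 1) ∧
            (∀ i, IsOpen (O i)) ∧ (∀ i, (O i).Nonempty) ∧
            (Pairwise fun i j => Disjoint (O i) (O j)) ∧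
            (⋃ i, O i) = (SchrodingerBroad.zeroSet P)ᶜ ∧
            ∀ i, SchrodingerBroad.broadNormPow k A K M p r τ B I f U ≤
              ENNReal.ofReal (c * D ^ (n + 1)) *
                SchrodingerBroad.broadNormPow k A K M p r τ B I f (U ∩ O i) := by
  have hc1 : (1 : ℝ) ≤ (4 * ((n : ℝ) + 1) ^ 2) ^ (n + 1) := by
    refine one_le_pow₀ ?_
    have : (1 : ℝ) ≤ ((n : ℝ) + 1) ^ 2 := one_le_pow₀ (by linarith [n.cast_nonneg (α := ℝ)])
    linarith
  refine ⟨(4 * ((n : ℝ) + 1) ^ 2) ^ (n + 1), by linarith, ?_⟩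
  intro k A K M R p r ξ₀ _ hk _ _ _ hp hr _ N N₁ N₂ τ B I _ hB hI f U _ _ D hD
  have hQ : ∀ b m, volume (B b ×ˢ I m) ≠ ∞ := by
    intro b m
    obtain ⟨a, ha⟩ := hB.small b
    obtain ⟨s, hs⟩ := hI.small m
    exact ((Metric.isBounded_closedBall.subset ha).prod
      ((Metric.isBounded_Icc _ _).subset hs)).measure_lt_top.ne
  let ν : Fin N₁ → Fin N₂ → Measure (SpaceTime n) := fun b m =>
    cellMeasure U (B b ×ˢ I m) (broadMass k A K M p τ f (B b ×ˢ I m))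
  have hνfin : ∀ b m, IsFiniteMeasure (ν b m) := fun b m =>
    isFiniteMeasure_cellMeasure U (broadMass_ne_top hk K M (zero_le_one.trans hp) τ f (hQ b m))
  have hνac : ∀ b m, ν b m ≪ volume := fun b m => cellMeasure_absolutelyContinuous _ _ _
  have hnorm : ∀ O, MeasurableSet O → broadNormPow k A K M p r τ B I f (U ∩ O) = mixedNorm r ν O :=
    fun O hO => broadNormPow_inter_eq_mixedNorm k A K M p r τ B I f U hO
  have hnormU : broadNormPow k A K M p r τ B I f U = mixedNorm r ν univ := by
    rw [← hnorm univ MeasurableSet.univ, inter_univ]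
  have hDpos : 0 ≤ D ^ (n + 1) := by positivity
  by_cases hzero : mixedNorm r ν univ = 0
  · -- A broad norm of zero gives no control on the cells: partition the unit ball instead, so
    -- that all cells are nonempty.
    obtain ⟨ν', _, hν'ac, hν'⟩ : ∃ ν' : Fin 1 → Fin 1 → Measure (SpaceTime n),
        (∀ b m, IsFiniteMeasure (ν' b m)) ∧ (∀ b m, ν' b m ≪ volume) ∧
          mixedNorm 1 ν' univ ≠ 0 := by
      refine ⟨fun _ _ => volume.restrict (Metric.ball 0 1),
        fun _ _ => isFiniteMeasure_restrict.2 measure_ball_lt_top.ne,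
        fun _ _ => Measure.absolutelyContinuous_restrict, ?_⟩
      simpa [mixedNorm] using (Metric.measure_ball_pos volume _ one_pos).ne'
    obtain ⟨P, hP, hdeg, L, O, hL1, hL2, hopen, hne, hdisj, hunion, -⟩ :=
      exists_partition_of_one_le le_rfl hν'ac hν' hD
    refine ⟨P, hP, hdeg, L, O, hL1, hL2.trans (le_mul_of_one_le_left hDpos hc1), hopen, hne, hdisj,
      hunion, fun i => ?_⟩
    rw [hnormU, hzero]
    exact bot_le
  · obtain ⟨P, hP, hdeg, L, O, hL1, hL2, hopen, hne, hdisj, hunion, hmass⟩ :=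
      exists_partition_of_one_le hr hνac hzero hD
    have hL3 := hL2.trans (le_mul_of_one_le_left hDpos hc1)
    refine ⟨P, hP, hdeg, L, O, hL1, hL3, hopen, hne, hdisj, hunion, fun i => ?_⟩
    rw [hnormU, hnorm _ (hopen i).measurableSet]
    refine (hmass i).trans ?_
    gcongr
    rw [← ENNReal.ofReal_natCast]
    exact ENNReal.ofReal_le_ofReal hL3
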